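/- Notation. Define $f_j\in\mathbb Z[u]$ for $j\in\mathbb Z$ by $f_0=0$, $f_1=1$, $f_{j+1}-uf_j+f_{j-1}=0$, put $g_j=f_j-f_{j-1}$, $\Phi_{2j}=f_j$, $\Phi_{2j-1}=g_j$, and $\Psi_k=\Phi_{k+1}-\Phi_{k-1}$. For integers $k,l$ let $J(k,l)\subset S^3$ be the double twist link, whose standard diagram consists of one box with $k$ and one box with $l$ half twists, and let $\pi_1(k,l)$ be the fundamental group of its complement, given by the Wirtinger presentation of this diagram: the generators are $a_j$ for $\min(0,l)\le j\le\max(0,l)+1$ and $b_j$ for $\min(0,k)\le j\le\max(0,k)+1$, and the relations are $a_ja_{j+1}=a_{j+1}a_{j+2}$ for $\min(0,l)\le j<\max(0,l)$, $b_jb_{j+1}=b_{j+1}b_{j+2}$ for $\min(0,k)\le j<\max(0,k)$ (one for each crossing), and $a_0=b_0^{-1}$, $a_1=b_k$, $a_l=b_1$, $a_{l+1}=b_{k+1}^{-1}$. Write $a=a_0$ and $b=b_1$; for even $l$ these are meridians of the knot. For a group $\Gamma$ let $\mathrm{Tr}(\Gamma)$ be the set of characters $\chi_\rho\colon\gamma\mapsto\mathrm{tr}\,\rho(\gamma)$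 of representations $\rho\colon\Gamma\to \mathrm{SL}_2(\mathbb C)$, with coordinate ring generated over $\mathbb C$ by the functions $t_\gamma\colon\chi\mapsto\chi(\gamma)$, $\gamma\in\Gamma$. Let $X(\Gamma)\subset \mathrm{Tr}(\Gamma)$ be the set of characters of nonabelian representations, and let $Y(\Gamma)$ be its image in $\mathrm{Tr}(\Gamma)/\mathrm{Hom}(\Gamma,\{\pm1\})$, where $(\sigma\chi)(\gamma)=\sigma(\gamma)\chi(\gamma)$ and where the coordinate ring of the quotient is the ring of invariants; $X(\Gamma)$ and $Y(\Gamma)$ carry the restrictions of these regular functions. Put $X(k,l)=X(\pi_1(k,l))$ and $Y(k,l)=Y(\pi_1(k,l))$. Proposition. Let $k,l$ be any integers with $l$ even, and put $n=l/2$. The variety $Y(k,l)$ is isomorphic to the subvariety $C(k,l)$ of $\mathbb A^2_{\mathbb C}(r,y)$ defined by $$f_n(t)\bigl(\Phi_{-k}(r)\Phi_{k-1}(r)(y-r)-1\bigr)+f_{n-1}(t)=0,\qquad t=\Phi_{-k}(r)\Psi_k(r)(y-r)+2,$$ and the variety $X(k,l)$ is isomorphic to the double cover of $C(k,l)$ defined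 in $\mathbb A^2_{\mathbb C}(r,x)$ by $y=x^2-2$. More precisely, the isomorphisms are given by $r=t_{ab^{-1}}$, $y=t_{a^2}$ and by $r=t_{ab^{-1}}$, $x=t_a$, and they identify the natural map $X(k,l)\to Y(k,l)$ with the covering map $(r,x)\mapsto(r,x^2-2)$. -/

import Mathlib

noncomputable section

namespace DoubleTwist

/-! ### Link diagrams and their Wirtinger groups -/

/-- A link diagram, recorded as in the construction of the Wirtinger presentation. The diagram is
cut into strands; each end of a strand is at a crossing, where it passes under another strand, or
at a joint. Each strand `s` carries a short transverse arrow passing underneath it; the loop of `s`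
runs from the base point (the eye of the reader, above the plane of the diagram) to the tail of the
arrow, along the arrow, and from its head back to the base point.
At a crossing `c` the strand `above c` passes over, and the strand below it is cut into `before c`
and `after c`, whose transverse arrows point to the same side; the strand `before c` lies on the
tail side and `after c` on the head side, such that the loops satisfy
`before * above = above * after`.
At a joint two strands are glued end to end, with arrows that agree (sign `1`) or that are opposite
to each other (sign `-1`). -/
structure LinkDiagram where
  Strand : Type
  Crossing : Type
  above : Crossing → Strand
  before : Crossing → Strand
  after : Crossing → Strand
  Joint : Type
  fst : Joint → Strand
  snd : Joint → Strand
  sign : Joint → ℤˣ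

/-- The relations of the Wirtinger presentation: one for each crossing, one for each joint. -/
def LinkDiagram.relations (D : LinkDiagram) : Set (FreeGroup D.Strand) :=
  {w | ∃ c : D.Crossing, w =
      FreeGroup.of (D.before c) * FreeGroup.of (D.above c) *
        (FreeGroup.of (D.above c) * FreeGroup.of (D.after c))⁻¹} ∪
  {w | ∃ i : D.Joint, w =
      FreeGroup.of (D.fst i) * (FreeGroup.of (D.snd i) ^ ((D.sign i : ℤˣ) : ℤ))⁻¹}

/-- The fundamental group of the complement in the three-sphere of the link with diagram `D`,
through its Wirtinger presentation. -/
abbrev LinkDiagram.group (D : LinkDiagram) : Type := PresentedGroup D.relations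

/-- Labels of the strands in a box of two strands with `c` half twists, `c` positive
(right-handed) or negative (left-handed): `0, …, c + 1` if `c ≥ 0`, and `c, …, 1` if `c ≤ 0`.
The strands `0` and `1` leave the box at one end, `c` and `c + 1` at the other end. -/
abbrev BoxStrand (c : ℤ) : Type := Set.Icc (min 0 c) (max 0 c + 1)

/-- The `|c|` crossings in such a box. At the crossing `j` the pair of neighbouring strands
`(j, j + 1)` turns into the pair `(j + 1, j + 2)`: the strand `j + 1` passes over, and the strand
below it is cut into `j` and `j + 2`. -/
abbrev BoxCrossing (c : ℤ) : Type := Set.Ico (min 0 c) (max 0 c)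

/-- The strand with label `j + i` at the crossing `j`, for `i = 0, 1, 2`. -/
def BoxCrossing.strand {c : ℤ} (j : BoxCrossing c) (i : ℤ) (h₀ : 0 ≤ i) (h₂ : i ≤ 2) :
    BoxStrand c :=
  ⟨j.1 + i, by have h₁ := j.2.1; omega, by have h₃ := j.2.2; omega⟩

/-- The two strands at the first end of the box. -/
def BoxStrand.zero (c : ℤ) : BoxStrand c := ⟨0, by omega, by omega⟩
/-- The two strands at the first end of the box. -/
def BoxStrand.one (c : ℤ) : BoxStrand c := ⟨1, by omega, by omega⟩
/-- The two strands at the last end of the box. -/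
def BoxStrand.last (c : ℤ) : BoxStrand c := ⟨c, by omega, by omega⟩
/-- The two strands at the last end of the box. -/
def BoxStrand.lastSucc (c : ℤ) : BoxStrand c := ⟨c + 1, by omega, by omega⟩

/-- The standard diagram of the double twist link `J(k,l)`. It has a box with `l` half twists
(strands `a_j`, the left summand) and a box with `k` half twists (strands `b_j`, the right summand),
glued by `a_0 = b_0⁻¹`, `a_1 = b_k`, `a_l = b_1` and `a_{l+1} = b_{k+1}⁻¹`. -/
def J (k l : ℤ) : LinkDiagram where
  Strand := BoxStrand l ⊕ BoxStrand k
  Crossing := BoxCrossing l ⊕ BoxCrossing k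
  above := Sum.map (fun j => j.strand 1 (by norm_num) (by norm_num))
    (fun j => j.strand 1 (by norm_num) (by norm_num))
  before := Sum.map (fun j => j.strand 0 (by norm_num) (by norm_num))
    (fun j => j.strand 0 (by norm_num) (by norm_num))
  after := Sum.map (fun j => j.strand 2 (by norm_num) (by norm_num))
    (fun j => j.strand 2 (by norm_num) (by norm_num))
  Joint := Fin 4
  fst := ![.inl (.zero l), .inl (.one l), .inl (.last l), .inl (.lastSucc l)]
  snd := ![.inr (.zero k), .inr (.last k), .inr (.one k), .inr (.lastSucc k)]
  sign := ![-1, 1, 1, -1]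

/-- The group `π₁(k,l)` of the link `J(k,l)`. -/
abbrev linkGroup (k l : ℤ) : Type := (J k l).group

/-- The loop `a = a_0` in `π₁(k,l)`. -/
def a (k l : ℤ) : linkGroup k l :=
  PresentedGroup.of (rels := (J k l).relations) (Sum.inl (BoxStrand.zero l))

/-- The loop `b = b_1` in `π₁(k,l)`. -/
def b (k l : ℤ) : linkGroup k l :=
  PresentedGroup.of (rels := (J k l).relations) (Sum.inr (BoxStrand.one k))

/-! ### Algebraic sets through their points and their regular functions

A complex affine algebraic set is treated as its set of points `S` with its coordinate ring, a
subalgebra of the algebra of all functions `S → ℂ`. -/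

/-- Composition with a map, as a homomorphism of algebras of functions. -/
def pullback {S S' : Type} (φ : S → S') : (S' → ℂ) →ₐ[ℂ] (S → ℂ) :=
  AlgHom.pi fun s => Pi.evalAlgHom ℂ (fun _ : S' => ℂ) (φ s)

theorem pullback_apply {S S' : Type} (φ : S → S') (f : S' → ℂ) (s : S) :
    pullback φ f s = f (φ s) := rfl

/-- The regular functions on a subset (with the induced structure): the restrictions of the regular
functions on the ambient set. -/
def restrictTo {S : Type} (A : Subalgebra ℂ (S → ℂ)) (Z : Set S) : Subalgebra ℂ (Z → ℂ) :=
  A.map (pullback Subtype.val)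

/-- An isomorphism of algebraic sets: a bijection of the points that identifies the regular
functions on both sides. -/
structure VarietyIso {S S' : Type} (A : Subalgebra ℂ (S → ℂ)) (A' : Subalgebra ℂ (S' → ℂ)) where
  toEquiv : S ≃ S'
  regular_iff : ∀ f : S' → ℂ, pullback toEquiv f ∈ A ↔ f ∈ A'

/-- The polynomial functions on the affine plane `ℂ × ℂ`. -/
def planeFunctions : Subalgebra ℂ (ℂ × ℂ → ℂ) := Algebra.adjoin ℂ {Prod.fst, Prod.snd}

/-! ### Character varieties -/

section CharacterVariety

variable (Γ : Type) [Group Γ]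

/-- Representations of `Γ` in `SL₂(ℂ)`. -/
abbrev Rep : Type := Γ →* Matrix.SpecialLinearGroup (Fin 2) ℂ

variable {Γ} in
/-- The character of a representation. -/
def character (ρ : Rep Γ) : Γ → ℂ := fun γ => (ρ γ : Matrix (Fin 2) (Fin 2) ℂ).trace

variable {Γ} in
/-- A representation is nonabelian if its image is not commutative. -/
def IsNonabelian (ρ : Rep Γ) : Prop := ∃ γ δ : Γ, ρ γ * ρ δ ≠ ρ δ * ρ γ

/-- The set `Tr(Γ)` of all characters of representations of `Γ` in `SL₂(ℂ)`. -/
def Tr : Set (Γ → ℂ) := Set.range (character (Γ := Γ))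

/-- The coordinate ring of `Tr(Γ)`, generated over `ℂ` by the functions `t_γ : χ ↦ χ(γ)`. -/
def TrFunctions : Subalgebra ℂ (Tr Γ → ℂ) :=
  Algebra.adjoin ℂ (Set.range fun (γ : Γ) (χ : Tr Γ) => χ.1 γ)

/-- The `SL₂(ℂ)`-character variety `X(Γ) ⊆ Tr(Γ)`: the characters of nonabelian representations. -/
def X : Set (Tr Γ) := {χ | ∃ ρ : Rep Γ, IsNonabelian ρ ∧ character ρ = χ.1}

/-- The coordinate ring of `X(Γ)`. -/
def XFunctions : Subalgebra ℂ (X Γ → ℂ) := restrictTo (TrFunctions Γ) (X Γ)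

/-- Being in the same orbit under `Hom(Γ, {±1})`, which acts on `Tr(Γ)` by
`(σ χ)(γ) = σ(γ) χ(γ)`. -/
def signSetoid : Setoid (Tr Γ) where
  r χ χ' := ∃ σ : Γ →* ℤˣ, ∀ γ, χ'.1 γ = ((σ γ : ℤ) : ℂ) * χ.1 γ
  iseqv :=
    { refl := fun χ => ⟨1, fun γ => by simp⟩
      symm := by
        rintro χ χ' ⟨σ, h⟩
        refine ⟨σ, fun γ => ?_⟩
        rw [h γ, ← mul_assoc, ← Int.cast_mul, ← Units.val_mul, Int.units_mul_self]
        simp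
      trans := by
        rintro χ χ' χ'' ⟨σ, h⟩ ⟨τ, h'⟩
        refine ⟨τ * σ, fun γ => ?_⟩
        rw [h' γ, h γ, ← mul_assoc]
        simp }

/-- The quotient `PTr(Γ) = Tr(Γ) / Hom(Γ, {±1})`, which is the
`PSL₂(ℂ)`-character variety of `Γ` when `Γ` is a knot group. -/
def PTr : Type := Quotient (signSetoid Γ)

/-- The quotient map `Tr(Γ) → PTr(Γ)`. -/
def toPTr (χ : Tr Γ) : PTr Γ := Quotient.mk (signSetoid Γ) χ

/-- The coordinate ring of `PTr(Γ)`: the functions on the quotient whose pullback to `Tr(Γ)` is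
regular, that is, the invariants in the coordinate ring of `Tr(Γ)`. -/
def PTrFunctions : Subalgebra ℂ (PTr Γ → ℂ) := (TrFunctions Γ).comap (pullback (toPTr Γ))

/-- The `PSL₂(ℂ)`-character variety `Y(Γ)`: the image of `X(Γ)` in `PTr(Γ)`. -/
def Y : Set (PTr Γ) := toPTr Γ '' X Γ

/-- The coordinate ring of `Y(Γ)`. -/
def YFunctions : Subalgebra ℂ (Y Γ → ℂ) := restrictTo (PTrFunctions Γ) (Y Γ)

variable {Γ} in
/-- The map `X(Γ) → Y(Γ)`. -/
def XtoY (χ : X Γ) : Y Γ := ⟨toPTr Γ χ.1, χ.1, χ.2, rfl⟩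

end CharacterVariety

/-! ### The polynomials and the curve -/

/-- The polynomials `f_j`, with `f_0 = 0`, `f_1 = 1` and `f_{j+1} - u f_j + f_{j-1} = 0` for all
integers `j`, see the three lemmas below. They are rescaled Chebyshev polynomials. -/
def f (j : ℤ) : Polynomial ℤ := Polynomial.Chebyshev.S ℤ (j - 1)

theorem f_zero : f 0 = 0 := by simp [f]

theorem f_one : f 1 = 1 := by simp [f]

theorem f_rec (j : ℤ) : f (j + 1) - Polynomial.X * f j + f (j - 1) = 0 := by
  have h := Polynomial.Chebyshev.S_eq ℤ j
  have e : j - 1 - 1 = j - 2 := by ring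
  simp only [f, add_sub_cancel_right, e]
  rw [h]
  ring

/-- `g_j = f_j - f_{j-1}`. -/
def g (j : ℤ) : Polynomial ℤ := f j - f (j - 1)

/-- `Φ_{2j} = f_j` and `Φ_{2j-1} = g_j`. -/
def Φ (k : ℤ) : Polynomial ℤ := if Even k then f (k / 2) else g ((k + 1) / 2)

theorem Φ_even (j : ℤ) : Φ (2 * j) = f j := by simp [Φ]

theorem Φ_odd (j : ℤ) : Φ (2 * j - 1) = g j := by
  have h : ¬ Even (2 * j - 1) := by rw [Int.even_iff]; omega
  have e : (2 * j - 1 + 1) / 2 = j := by omega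
  rw [Φ, if_neg h, e]

/-- `Ψ_k = Φ_{k+1} - Φ_{k-1}`. -/
def Ψ (k : ℤ) : Polynomial ℤ := Φ (k + 1) - Φ (k - 1)

open Polynomial in
/-- `t = Φ_{-k}(r) Ψ_k(r) (y - r) + 2`. -/
def t (k : ℤ) (r y : ℂ) : ℂ := aeval r (Φ (-k)) * aeval r (Ψ k) * (y - r) + 2

open Polynomial in
/-- The curve `C(k,l)` in the plane with coordinates `(r, y)`, for even `l`, with `n = l / 2`. -/
def C (k l : ℤ) : Set (ℂ × ℂ) :=
  {p | aeval (t k p.1 p.2) (f (l / 2)) *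
        (aeval p.1 (Φ (-k)) * aeval p.1 (Φ (k - 1)) * (p.2 - p.1) - 1) +
      aeval (t k p.1 p.2) (f (l / 2 - 1)) = 0}

/-- The double cover of `C(k,l)` in the plane with coordinates `(r, x)`, given by `y = x ^ 2 - 2`. -/
def DoubleCover (k l : ℤ) : Set (ℂ × ℂ) := {p | (p.1, p.2 ^ 2 - 2) ∈ C k l}

/-- The covering map `(r, x) ↦ (r, x ^ 2 - 2)`. -/
def coverMap {k l : ℤ} (p : DoubleCover k l) : C k l := ⟨(p.1.1, p.1.2 ^ 2 - 2), p.2⟩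

end DoubleTwist

end

/-!
The loops in a box satisfy `w j * w (j + 1) = w (j + 1) * w (j + 2)`, so all products of neighbours
are equal and `w (j + 2)` is the conjugate of `w j` by this product. Hence the relations of the
Wirtinger presentation can be solved from one end of each box: `π₁(k,l)` is generated by `a` and `b`
with the single relation `b = A ^ (-n) * a * A ^ n`, where `A = a * b_k` and `b_k` is conjugate to
`a⁻¹` or `b` by a power of `a⁻¹ * b` (`closure_a_b`, `b_eq_twist`, `exists_hom`). In particular
`a` and `b` are conjugate.

For matrices `u`, `v` in `SL₂(ℂ)` of the same trace `x`, with `r = tr (u v⁻¹)` and `y = x ^ 2 - 2`,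
the Cayley–Hamilton theorem expresses powers through the polynomials `f_j`, and a computation in the
span of `1`, `u`, `v`, `u v` gives (`trace_and_commutation`)
`tr A = t` and `u A - A v = (1 - Φ_{-k}(r) Φ_{k-1}(r) (y - r)) (u - v)`.
Writing `A ^ n = f_n(t) A - f_{n-1}(t)`, one finds that `u A ^ n - A ^ n v` is the negative of the
equation of `C(k,l)`, times `u - v`. A representation is nonabelian only if `u ≠ v`, so for
nonabelian representations the relation of the group is the equation of the curve
(`relation_iff_mem_C`). Conversely every point of the curve comes from a noncommuting pair: one can
be written down except at `r = y = 2`, and this point is not on `C(k,l)` (`mem_C_iff`). Reducible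
nonabelian representations need no separate treatment.

It remains to compare the regular functions. As `a` and `b` are conjugate generators, every
character is a polynomial function of `r = t_{ab⁻¹}` and `x = t_a` (`exists_expansion`), so these two
functions embed `Tr(Γ)` into the plane and generate its coordinate ring. All strands can be sent to
`-1`, so `Hom(Γ, {±1})` acts by `x ↦ ±x`; the invariants are the polynomials in `r` and `x ^ 2 - 2`,
and these embed the quotient (`PTrFunctions_eq`, `pTraces_injective`).
-/

noncomputable section

namespace DoubleTwist

/-! ### Sequences of loops in a box of half twists -/

section Twist

variable {G : Type*} [Group G]

/-- The sequence `w` with `w 0 = u`, `w 1 = v` and `w j * w (j + 1) = w (j + 1) * w (j + 2)`, in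
closed form: all the products `w j * w (j + 1)` are equal to `u * v`, so that passing from `j` to
`j + 2` is conjugation by `u * v`. -/
def twist (u v : G) (j : ℤ) : G :=
  (u * v) ^ (-(j / 2)) * (if Even j then u else v) * (u * v) ^ (j / 2)

theorem twist_even (u v : G) (m : ℤ) :
    twist u v (2 * m) = (u * v) ^ (-m) * u * (u * v) ^ m := by
  simp [twist]

theorem twist_odd (u v : G) (m : ℤ) :
    twist u v (2 * m + 1) = (u * v) ^ (-m) * v * (u * v) ^ m := by
  have h : ¬ Even (2 * m + 1) := by rw [Int.even_iff]; omega
  have e : (2 * m + 1) / 2 = m := by omega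
  rw [twist, if_neg h, e]

theorem twist_zero (u v : G) : twist u v 0 = u := by simpa using twist_even u v 0

theorem twist_one (u v : G) : twist u v 1 = v := by simpa using twist_odd u v 0

theorem twist_mul_twist_succ (u v : G) (j : ℤ) : twist u v j * twist u v (j + 1) = u * v := by
  obtain ⟨m, rfl | rfl⟩ := Int.even_or_odd' j
  · rw [twist_even, twist_odd, zpow_neg]
    have h : u * (u * v) ^ m * (((u * v) ^ m)⁻¹ * v * (u * v) ^ m) = (u * v) ^ m * (u * v) := by
      rw [← zpow_add_one, add_comm, zpow_one_add]
      simp [mul_assoc]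
    rw [mul_assoc, mul_assoc, ← mul_assoc u, h]
    simp
  · rw [show 2 * m + 1 + 1 = 2 * (m + 1) by ring, twist_even, twist_odd, neg_add, zpow_add,
      zpow_add, zpow_neg, zpow_neg, zpow_one]
    have h : v * (u * v) ^ m * (((u * v) ^ m)⁻¹ * (u * v)⁻¹ * u * ((u * v) ^ m * (u * v)))
        = (u * v) ^ m * (u * v) := by group
    rw [mul_assoc, mul_assoc, ← mul_assoc v, h]
    group

theorem twist_crossing (u v : G) (j : ℤ) :
    twist u v j * twist u v (j + 1) = twist u v (j + 1) * twist u v (j + 2) := by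
  rw [twist_mul_twist_succ, show j + 2 = j + 1 + 1 by ring, twist_mul_twist_succ]

theorem twist_mem {H : Subgroup G} {u v : G} (hu : u ∈ H) (hv : v ∈ H) (j : ℤ) :
    twist u v j ∈ H := by
  have huv := H.mul_mem hu hv
  refine H.mul_mem (H.mul_mem (H.zpow_mem huv _) ?_) (H.zpow_mem huv _)
  split_ifs <;> assumption

theorem map_twist {G' : Type*} [Group G'] (φ : G →* G') (u v : G) (j : ℤ) :
    φ (twist u v j) = twist (φ u) (φ v) j := by
  simp only [twist, map_mul, map_zpow]
  split_ifs <;> rfl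

/-- The crossing relations of a box determine the loops of all its strands by the loops of the two
strands at the first end. -/
theorem eq_twist_of_crossing {c : ℤ} (w : BoxStrand c → G)
    (hw : ∀ j : BoxCrossing c,
      w (j.strand 0 (by norm_num) (by norm_num)) * w (j.strand 1 (by norm_num) (by norm_num)) =
      w (j.strand 1 (by norm_num) (by norm_num)) * w (j.strand 2 (by norm_num) (by norm_num)))
    (i : BoxStrand c) : w i = twist (w (.zero c)) (w (.one c)) i.1 := by
  -- Extend `w` to all integers, so that the indices can be computed with.
  let W : ℤ → G := fun j => if h : j ∈ Set.Icc (min 0 c) (max 0 c + 1) then w ⟨j, h⟩ else 1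
  have hW : ∀ i : BoxStrand c, w i = W i.1 := by
    intro i
    simp only [W]
    split_ifs with h
    · rfl
    · exact absurd i.2 h
  have hrel : ∀ j, min 0 c ≤ j → j < max 0 c → W j * W (j + 1) = W (j + 1) * W (j + 2) := by
    intro j h₁ h₂
    have h := hw ⟨j, h₁, h₂⟩
    simpa only [hW, BoxCrossing.strand, add_zero] using h
  rw [hW i, hW, hW]
  change W i.1 = twist (W 0) (W 1) i.1
  generalize i.1 = i, i.2 = hi'
  obtain ⟨h₁, h₂⟩ := hi'
  have up : ∀ j : ℕ, (j : ℤ) ≤ max 0 c →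
      W j = twist (W 0) (W 1) j ∧ W (j + 1) = twist (W 0) (W 1) (j + 1) := by
    intro j
    induction j with
    | zero => intro _; simp [twist_zero, twist_one]
    | succ j ih =>
      intro hj
      push_cast at hj ⊢
      obtain ⟨e₀, e₁⟩ := ih (by omega)
      refine ⟨e₁, ?_⟩
      have h := hrel j (by omega) (by omega)
      have h' := twist_crossing (W 0) (W 1) j
      rw [← e₀, ← e₁, h] at h'
      rw [show (j : ℤ) + 1 + 1 = j + 2 by ring]
      exact mul_left_cancel h'
  have down : ∀ j : ℕ, min 0 c ≤ -(j : ℤ) →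
      W (-j) = twist (W 0) (W 1) (-j) ∧ W (-j + 1) = twist (W 0) (W 1) (-j + 1) := by
    intro j
    induction j with
    | zero => intro _; simp [twist_zero, twist_one]
    | succ j ih =>
      intro hj
      push_cast at hj ⊢
      obtain ⟨e₀, e₁⟩ := ih (by omega)
      have hj' : -((j : ℤ) + 1) + 1 = -j := by ring
      have hj'' : -((j : ℤ) + 1) + 2 = -j + 1 := by ring
      rw [hj']
      refine ⟨?_, e₀⟩
      have h := hrel (-((j : ℤ) + 1)) (by omega) (by omega)
      have h' := twist_crossing (W 0) (W 1) (-((j : ℤ) + 1))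
      rw [hj', hj''] at h h'
      rw [← e₀, ← e₁, ← h] at h'
      exact (mul_right_cancel h').symm
  obtain hi | hi := le_total 0 i
  · lift i to ℕ using hi
    by_cases hc : (i : ℤ) ≤ max 0 c
    · exact (up i hc).1
    · have e : (i : ℤ) = ((i - 1 : ℕ) : ℤ) + 1 := by omega
      rw [e]
      exact (up (i - 1) (by omega)).2
  · have e : i = -((-i).toNat : ℤ) := by omega
    rw [e]
    exact (down _ (by omega)).1

end Twist

/-! ### The group of `J(k,l)` as a group with two generators and one relation -/

section LinkGroup

variable (k l : ℤ)

/-- The loop of a strand of the box with `l` half twists. -/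
def aLoop (i : BoxStrand l) : linkGroup k l :=
  PresentedGroup.of (rels := (J k l).relations) (Sum.inl i)

/-- The loop of a strand of the box with `k` half twists. -/
def bLoop (i : BoxStrand k) : linkGroup k l :=
  PresentedGroup.of (rels := (J k l).relations) (Sum.inr i)

theorem crossing_relation (c : (J k l).Crossing) :
    PresentedGroup.of (rels := (J k l).relations) ((J k l).before c) *
      PresentedGroup.of ((J k l).above c) =
    PresentedGroup.of ((J k l).above c) * PresentedGroup.of ((J k l).after c) :=
  mul_inv_eq_one.mp (PresentedGroup.one_of_mem (rels := (J k l).relations) (Or.inl ⟨c, rfl⟩))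

theorem joint_relation (i : (J k l).Joint) :
    PresentedGroup.of (rels := (J k l).relations) ((J k l).fst i) =
      PresentedGroup.of ((J k l).snd i) ^ (((J k l).sign i : ℤˣ) : ℤ) :=
  mul_inv_eq_one.mp (PresentedGroup.one_of_mem (rels := (J k l).relations) (Or.inr ⟨i, rfl⟩))

theorem bLoop_zero : bLoop k l (.zero k) = (a k l)⁻¹ := by
  have h : a k l = bLoop k l (.zero k) ^ (-1 : ℤ) := joint_relation k l (0 : Fin 4)
  rw [h]
  simp

theorem bLoop_eq (i : BoxStrand k) : bLoop k l i = twist (a k l)⁻¹ (b k l) i.1 := by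
  rw [← bLoop_zero]
  exact eq_twist_of_crossing (bLoop k l) (fun j => crossing_relation k l (Sum.inr j)) i

theorem aLoop_one : aLoop k l (.one l) = twist (a k l)⁻¹ (b k l) k := by
  have h : aLoop k l (.one l) = bLoop k l (.last k) ^ (1 : ℤ) := joint_relation k l (1 : Fin 4)
  rw [h, zpow_one, bLoop_eq]
  rfl

theorem aLoop_eq (i : BoxStrand l) :
    aLoop k l i = twist (a k l) (twist (a k l)⁻¹ (b k l) k) i.1 := by
  rw [← aLoop_one]
  exact eq_twist_of_crossing (aLoop k l) (fun j => crossing_relation k l (Sum.inl j)) i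

/-- The relation between the generators `a` and `b`, from the third joint: it says that
`b = A ^ (-n) * a * A ^ n` if `l = 2 * n`, where `A = a * twist a⁻¹ b k`. -/
theorem b_eq_twist : b k l = twist (a k l) (twist (a k l)⁻¹ (b k l) k) l := by
  have h : aLoop k l (.last l) = b k l ^ (1 : ℤ) := joint_relation k l (2 : Fin 4)
  rw [zpow_one] at h
  exact h.symm.trans (aLoop_eq k l _)

theorem closure_a_b : Subgroup.closure {a k l, b k l} = ⊤ := by
  have ha : a k l ∈ Subgroup.closure {a k l, b k l} := Subgroup.subset_closure (by simp)
  have hb : b k l ∈ Subgroup.closure {a k l, b k l} := Subgroup.subset_closure (by simp)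
  have hk := fun j => twist_mem (inv_mem ha) hb j
  rw [eq_top_iff, ← PresentedGroup.closure_range_of (J k l).relations, Subgroup.closure_le]
  rintro _ ⟨i | i, rfl⟩
  · change aLoop k l i ∈ _
    rw [aLoop_eq]
    exact twist_mem ha (hk k) _
  · change bLoop k l i ∈ _
    rw [bLoop_eq]
    exact hk _

/-- The relation `b_eq_twist` is the only one. The fourth joint adds nothing, as the products of the
two loops at both ends of a box are equal. -/
theorem exists_hom {G : Type*} [Group G] (u v : G) (h : v = twist u (twist u⁻¹ v k) l) :
    ∃ ρ : linkGroup k l →* G, ρ (a k l) = u ∧ ρ (b k l) = v := by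
  let w : (J k l).Strand → G :=
    Sum.elim (fun i : BoxStrand l => twist u (twist u⁻¹ v k) i.1)
      (fun i : BoxStrand k => twist u⁻¹ v i.1)
  have hw : ∀ s ∈ (J k l).relations, FreeGroup.lift w s = 1 := by
    rintro s (⟨c | c, rfl⟩ | ⟨i, rfl⟩)
    · have := twist_crossing u (twist u⁻¹ v k) c.1
      simp only [map_mul, map_inv, FreeGroup.lift_apply_of, mul_inv_eq_one]
      simpa [w, J, BoxCrossing.strand] using this
    · have := twist_crossing u⁻¹ v c.1
      simp only [map_mul, map_inv, FreeGroup.lift_apply_of, mul_inv_eq_one]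
      simpa [w, J, BoxCrossing.strand] using this
    · simp only [map_mul, map_inv, map_zpow, FreeGroup.lift_apply_of, mul_inv_eq_one]
      change Fin 4 at i
      fin_cases i
      · change twist u _ 0 = twist u⁻¹ v 0 ^ (-1 : ℤ)
        simp [twist_zero]
      · change twist u _ 1 = twist u⁻¹ v k ^ (1 : ℤ)
        simp [twist_one]
      · change twist u _ l = twist u⁻¹ v 1 ^ (1 : ℤ)
        simp [twist_one, ← h]
      · change twist u _ (l + 1) = twist u⁻¹ v (k + 1) ^ (-1 : ℤ)
        have h₁ := twist_mul_twist_succ u (twist u⁻¹ v k) l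
        have h₂ := twist_mul_twist_succ u⁻¹ v k
        rw [← h] at h₁
        rw [zpow_neg_one, eq_inv_iff_mul_eq_one, ← mul_right_inj v, ← mul_assoc, h₁, mul_assoc, h₂]
        simp
  refine ⟨PresentedGroup.toGroup hw, ?_, ?_⟩
  · exact (PresentedGroup.toGroup.of hw).trans (twist_zero _ _)
  · exact (PresentedGroup.toGroup.of hw).trans (twist_one _ _)

theorem isConj_a_b (hl : Even l) : IsConj (a k l) (b k l) := by
  obtain ⟨n, hn⟩ := even_iff_two_dvd.mp hl
  generalize hA : a k l * twist (a k l)⁻¹ (b k l) k = A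
  have h : b k l = A ^ (-n) * a k l * A ^ n := by
    have h := b_eq_twist k l
    rw [← hA, ← twist_even, ← hn]
    exact h
  rw [isConj_iff]
  exact ⟨A ^ (-n), by rw [h]; group⟩

/-- All the relations hold in `{±1}` if the loop of every strand is sent to `-1`. -/
theorem exists_sign : ∃ σ : linkGroup k l →* ℤˣ, σ (a k l) = -1 := by
  obtain ⟨σ, h, -⟩ := exists_hom k l (-1 : ℤˣ) (-1) (by simp [twist])
  exact ⟨σ, h⟩

end LinkGroup

/-! ### Computations in an algebra with two generators of equal trace -/

section Algebra

variable {R : Type*} [Ring R] [Algebra ℂ R] {a b : R} {x r p q : ℂ}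

/-- The even case: here `b⁻¹ = x - b`, `a⁻¹ = x - a`, and with `B = a⁻¹ * b` and `B ^ m = p B - q`
the element `A` is `a * B ^ (-m) * a⁻¹ * B ^ m`. -/
theorem trace_and_commutation_even (haa : a * a = x • a - 1) (hbb : b * b = x • b - 1)
    (hba : b * a = x • a + x • b - r • 1 - a * b) (hpq : p ^ 2 + q ^ 2 - r * p * q = 1)
    (τ : R →ₗ[ℂ] ℂ) (h1 : τ 1 = 2) (ha : τ a = x) (hb : τ b = x) (hab : τ (a * b) = x ^ 2 - r)
    {A : R} (hA : A = (p • (a * (x • 1 - b)) - q • 1) * (p • ((x • 1 - a) * b) - q • 1)) :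
    τ A = p ^ 2 * (2 - r) * (x ^ 2 - 2 - r) + 2 ∧
      a * A - A * b = (1 + p * (p - q) * (x ^ 2 - 2 - r)) • (a - b) := by
  -- Oriented from left to right, the relations bring every element into the span of
  -- `1`, `a`, `b` and `a * b`.
  have haa' (c : R) : a * (a * c) = x • (a * c) - c := by
    rw [← mul_assoc, haa, sub_mul, one_mul, smul_mul_assoc]
  have hba' (c : R) : b * (a * c) = x • (a * c) + x • (b * c) - r • c - a * (b * c) := by
    rw [← mul_assoc, hba]
    simp only [sub_mul, add_mul, one_mul, smul_mul_assoc, mul_assoc]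
  constructor
  · simp only [hA, mul_sub, sub_mul, mul_add, smul_sub, smul_add, smul_mul_assoc, mul_smul_comm,
      mul_assoc, one_mul, mul_one, haa, hbb, haa', hba', smul_smul, map_sub, map_add,
      map_smul, h1, ha, hb, hab, smul_eq_mul]
    linear_combination 2 * hpq
  · simp only [hA, mul_sub, sub_mul, mul_add, add_mul, smul_sub, smul_add, smul_mul_assoc,
      mul_smul_comm, mul_assoc, one_mul, mul_one, haa, hbb, haa', hba']
    linear_combination (norm := module) hpq • (a - b)

/-- The odd case: here `b⁻¹ = x - b`, `a⁻¹ = x - a`, and with `B = a⁻¹ * b` and `B ^ m = p B - q`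
the element `A` is `a * B ^ (-m) * b * B ^ m`. -/
theorem trace_and_commutation_odd (haa : a * a = x • a - 1) (hbb : b * b = x • b - 1)
    (hba : b * a = x • a + x • b - r • 1 - a * b) (hpq : p ^ 2 + q ^ 2 - r * p * q = 1)
    (τ : R →ₗ[ℂ] ℂ) (h1 : τ 1 = 2) (ha : τ a = x) (hb : τ b = x) (hab : τ (a * b) = x ^ 2 - r)
    {A : R}
    (hA : A = a * (p • ((x • 1 - b) * a) - q • 1) * b * (p • ((x • 1 - a) * b) - q • 1)) :
    τ A = (r * p - q - p) ^ 2 * (x ^ 2 - 2 - r) + 2 ∧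
      a * A - A * b = (1 - (r * p - q - p) * p * (x ^ 2 - 2 - r)) • (a - b) := by
  have haa' (c : R) : a * (a * c) = x • (a * c) - c := by
    rw [← mul_assoc, haa, sub_mul, one_mul, smul_mul_assoc]
  have hba' (c : R) : b * (a * c) = x • (a * c) + x • (b * c) - r • c - a * (b * c) := by
    rw [← mul_assoc, hba]
    simp only [sub_mul, add_mul, one_mul, smul_mul_assoc, mul_assoc]
  constructor
  · simp only [hA, mul_sub, sub_mul, mul_add, add_mul, smul_sub, smul_add, smul_mul_assoc,
      mul_smul_comm, mul_assoc, one_mul, mul_one, haa, hbb, hba, haa', hba', smul_smul, map_sub,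
      map_add, map_smul, h1, ha, hb, hab, smul_eq_mul]
    linear_combination 2 * hpq
  · simp only [hA, mul_sub, sub_mul, mul_add, add_mul, smul_sub, smul_add, smul_mul_assoc,
      mul_smul_comm, mul_assoc, one_mul, mul_one, haa, hbb, hba, haa', hba']
    linear_combination (norm := module) hpq • (a - b)

end Algebra

/-! ### Traces and powers of two-by-two matrices -/

section Matrices

open Polynomial

open Matrix (trace_fin_two SpecialLinearGroup)

theorem aeval_f_succ (r : ℂ) (j : ℤ) :
    aeval r (f (j + 1)) = r * aeval r (f j) - aeval r (f (j - 1)) := by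
  have h := congrArg (aeval r) (f_rec j)
  simp only [map_add, map_sub, map_mul, aeval_X, map_zero] at h
  linear_combination h

theorem f_neg (j : ℤ) : f (-j) = -f j := by
  rw [f, f, Polynomial.Chebyshev.S_neg_sub_one]

theorem aeval_f_sq (r : ℂ) (j : ℤ) :
    aeval r (f j) ^ 2 + aeval r (f (j - 1)) ^ 2 - r * aeval r (f j) * aeval r (f (j - 1)) = 1 := by
  have h := congrArg (aeval r) (Polynomial.Chebyshev.S_sq_add_S_sq ℤ (j - 1 - 1))
  simp only [map_add, map_sub, map_mul, map_pow, aeval_X, map_one, sub_add_cancel] at h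
  simp only [f]
  linear_combination h

theorem aeval_f_two (j : ℤ) : aeval (2 : ℂ) (f j) = j := by
  have h := Polynomial.Chebyshev.S_eval_two ℤ (j - 1)
  have e : (2 : ℂ) = algebraMap ℤ ℂ 2 := by simp
  rw [f, e, aeval_algebraMap_apply]
  simp [h]

/-- The underlying matrix of an element of `SL₂(ℂ)`. -/
abbrev mat (M : SpecialLinearGroup (Fin 2) ℂ) : Matrix (Fin 2) (Fin 2) ℂ := M.1

theorem mat_mul (M N : SpecialLinearGroup (Fin 2) ℂ) : mat (M * N) = mat M * mat N := rfl

theorem mat_one : mat 1 = 1 := rfl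

theorem mat_inv (M : SpecialLinearGroup (Fin 2) ℂ) :
    mat M⁻¹ = (mat M).trace • 1 - mat M := by
  have h : mat M⁻¹ = (mat M).adjugate := rfl
  rw [h, Matrix.adjugate_fin_two]
  ext i j
  fin_cases i <;> fin_cases j <;> simp [trace_fin_two]

theorem trace_mat_inv (M : SpecialLinearGroup (Fin 2) ℂ) : (mat M⁻¹).trace = (mat M).trace := by
  rw [mat_inv]
  simp
  ring

theorem mat_mul_self (M : SpecialLinearGroup (Fin 2) ℂ) :
    mat M * mat M = (mat M).trace • mat M - 1 := by
  have h : mat M * mat M⁻¹ = 1 := by rw [← mat_mul, mul_inv_cancel, mat_one]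
  rw [mat_inv, mul_sub, mul_smul_comm, mul_one] at h
  rw [← h, sub_sub_cancel]

/-- The polarized Cayley–Hamilton relation, for matrices of equal trace. -/
theorem mat_mul_comm (M N : SpecialLinearGroup (Fin 2) ℂ) {x : ℂ} (hM : (mat M).trace = x)
    (hN : (mat N).trace = x) :
    mat N * mat M =
      x • mat M + x • mat N - (mat (M * N⁻¹)).trace • (1 : Matrix (Fin 2) (Fin 2) ℂ) -
        mat M * mat N := by
  have h : mat (M * N⁻¹) + mat (M * N⁻¹)⁻¹ = (mat (M * N⁻¹)).trace • 1 := by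
    rw [mat_inv]
    abel
  rw [← h, mul_inv_rev, inv_inv, mat_mul, mat_mul, mat_inv, mat_inv, hM, hN, mul_sub, mul_sub,
    mul_smul_comm, mul_smul_comm, mul_one, mul_one]
  abel

theorem trace_mat_mul (M N : SpecialLinearGroup (Fin 2) ℂ) {x : ℂ} (hM : (mat M).trace = x)
    (hN : (mat N).trace = x) : (mat M * mat N).trace = x ^ 2 - (mat (M * N⁻¹)).trace := by
  rw [mat_mul, mat_inv, mul_sub, mul_smul_comm, mul_one, Matrix.trace_sub, Matrix.trace_smul, hM,
    hN, smul_eq_mul]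
  ring

/-- Powers of a matrix in `SL₂(ℂ)`, from the Cayley–Hamilton theorem. -/
theorem mat_zpow (M : SpecialLinearGroup (Fin 2) ℂ) {r : ℂ} (hr : (mat M).trace = r) (m : ℤ) :
    mat (M ^ m) = aeval r (f m) • mat M - aeval r (f (m - 1)) • 1 := by
  induction m with
  | zero => simp [f_zero, f_neg, f_one]
  | succ m ih =>
    rw [zpow_add_one, mat_mul, ih, sub_mul, smul_mul_assoc, smul_mul_assoc, mat_mul_self, one_mul,
      aeval_f_succ, hr, add_sub_cancel_right]
    module
  | pred m ih =>
    have h := aeval_f_succ r (-(m : ℤ) - 1)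
    rw [sub_add_cancel] at h
    rw [zpow_sub_one, mat_mul, ih, sub_mul, smul_mul_assoc, smul_mul_assoc, mat_inv, mul_sub,
      mat_mul_self, one_mul, mul_smul_comm, mul_one, hr, h]
    module

theorem Φ_neg_even (m : ℤ) : Φ (-(2 * m)) = -f m := by
  rw [show -(2 * m) = 2 * (-m) by ring, Φ_even, f_neg]

theorem Φ_neg_odd (m : ℤ) : Φ (-(2 * m + 1)) = f (m + 1) - f m := by
  rw [show -(2 * m + 1) = 2 * (-m) - 1 by ring, Φ_odd, g, f_neg,
    show -m - 1 = -(m + 1) by ring, f_neg]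
  ring

theorem Ψ_even (m : ℤ) : Ψ (2 * m) = f (m + 1) - f m - (f m - f (m - 1)) := by
  rw [Ψ, Φ_odd, show 2 * m + 1 = 2 * (m + 1) - 1 by ring, Φ_odd, g, g, add_sub_cancel_right]

theorem Ψ_odd (m : ℤ) : Ψ (2 * m + 1) = f (m + 1) - f m := by
  rw [Ψ, add_sub_cancel_right, Φ_even, show 2 * m + 1 + 1 = 2 * (m + 1) by ring, Φ_even]

/-- With `A = u * twist u⁻¹ v k`, both the trace of `A` and the factor by which `u - v` is
multiplied in `u A - A v` are polynomials in the traces of `u`, `v` and `u * v⁻¹`. -/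
theorem trace_and_commutation (k : ℤ) (u v : SpecialLinearGroup (Fin 2) ℂ) {x r : ℂ}
    (hu : (mat u).trace = x) (hv : (mat v).trace = x) (hr : (mat (u * v⁻¹)).trace = r) :
    (mat (u * twist u⁻¹ v k)).trace = t k r (x ^ 2 - 2) ∧
      mat u * mat (u * twist u⁻¹ v k) - mat (u * twist u⁻¹ v k) * mat v =
        (1 - aeval r (Φ (-k)) * aeval r (Φ (k - 1)) * (x ^ 2 - 2 - r)) • (mat u - mat v) := by
  have hr₁ : (mat (u⁻¹ * v)).trace = r := by
    rw [← hr, ← trace_mat_inv, mul_inv_rev, inv_inv, mat_mul, mat_mul, Matrix.trace_mul_comm]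
  have hr₂ : (mat (v⁻¹ * u)).trace = r := by rw [← hr, mat_mul, mat_mul, Matrix.trace_mul_comm]
  have huu := mat_mul_self u
  have hvv := mat_mul_self v
  have hvu := mat_mul_comm u v hu hv
  have huv := trace_mat_mul u v hu hv
  rw [hr] at huv hvu
  rw [hu] at huu
  rw [hv] at hvv
  obtain ⟨m, rfl | rfl⟩ := Int.even_or_odd' k
  · have hA : u * twist u⁻¹ v (2 * m) = (u * v⁻¹) ^ m * (u⁻¹ * v) ^ m := by
      have h : (u * v⁻¹) ^ m = u * (u⁻¹ * v) ^ (-m) * u⁻¹ := by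
        rw [zpow_neg, ← inv_zpow, ← conj_zpow]
        group
      rw [twist_even, h]
      group
    obtain ⟨h₁, h₂⟩ := trace_and_commutation_even (A := mat (u * twist u⁻¹ v (2 * m)))
      huu hvv hvu (aeval_f_sq r m) (Matrix.traceLinearMap (Fin 2) ℂ ℂ) (by simp) hu hv huv (by
        rw [hA, mat_mul, mat_zpow _ hr, mat_zpow _ hr₁, mat_mul, mat_mul, mat_inv, mat_inv, hu, hv])
    refine ⟨h₁.trans ?_, h₂.trans ?_⟩
    · rw [t, Φ_neg_even, Ψ_even]
      simp only [map_neg, map_sub, aeval_f_succ]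
      ring
    · rw [Φ_neg_even, Φ_odd, g]
      simp only [map_neg, map_sub]
      congr 1
      ring
  · have hA : u * twist u⁻¹ v (2 * m + 1) = u * (v⁻¹ * u) ^ m * v * (u⁻¹ * v) ^ m := by
      have h : (v⁻¹ * u) ^ m = (u⁻¹ * v) ^ (-m) := by
        rw [zpow_neg, ← inv_zpow, mul_inv_rev, inv_inv]
      rw [twist_odd, h]
      group
    obtain ⟨h₁, h₂⟩ := trace_and_commutation_odd (A := mat (u * twist u⁻¹ v (2 * m + 1)))
      huu hvv hvu (aeval_f_sq r m) (Matrix.traceLinearMap (Fin 2) ℂ ℂ) (by simp) hu hv huv (by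
        rw [hA, mat_mul, mat_mul, mat_mul, mat_zpow _ hr₂, mat_zpow _ hr₁, mat_mul, mat_mul,
          mat_inv, mat_inv, hu, hv])
    refine ⟨h₁.trans ?_, h₂.trans ?_⟩
    · rw [t, Φ_neg_odd, Ψ_odd]
      simp only [map_sub, aeval_f_succ]
      ring
    · rw [Φ_neg_odd, add_sub_cancel_right, Φ_even]
      simp only [map_sub, aeval_f_succ]

/-- For distinct `u` and `v` of equal trace, the relation of the group holds exactly if the
traces give a point of the curve. -/
theorem relation_iff_mem_C {k l : ℤ} (hl : Even l) {u v : SpecialLinearGroup (Fin 2) ℂ} {x r : ℂ}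
    (hu : (mat u).trace = x) (hv : (mat v).trace = x) (hr : (mat (u * v⁻¹)).trace = r)
    (huv : u ≠ v) : v = twist u (twist u⁻¹ v k) l ↔ (r, x ^ 2 - 2) ∈ C k l := by
  obtain ⟨n, rfl⟩ := even_iff_two_dvd.mp hl
  obtain ⟨ht, hA⟩ := trace_and_commutation k u v hu hv hr
  have hne : mat u - mat v ≠ 0 := fun h => huv (Subtype.ext (sub_eq_zero.mp h))
  rw [twist_even]
  generalize u * twist u⁻¹ v k = A at ht hA
  have h₁ : v = A ^ (-n) * u * A ^ n ↔ mat u * mat (A ^ n) - mat (A ^ n) * mat v = 0 := by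
    rw [sub_eq_zero, ← mat_mul, ← mat_mul, zpow_neg, mul_assoc, eq_inv_mul_iff_mul_eq, eq_comm]
    exact Subtype.ext_iff
  -- Expand `A ^ n` by Cayley–Hamilton and collect the multiples of `u - v`.
  have e : mat u * mat (A ^ n) - mat (A ^ n) * mat v =
      -(aeval (t k r (x ^ 2 - 2)) (f n) *
        (aeval r (Φ (-k)) * aeval r (Φ (k - 1)) * (x ^ 2 - 2 - r) - 1) +
      aeval (t k r (x ^ 2 - 2)) (f (n - 1))) • (mat u - mat v) := by
    rw [mat_zpow A ht, mul_sub, sub_mul, mul_smul_comm, smul_mul_assoc, mul_smul_comm,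
      smul_mul_assoc, mul_one, one_mul]
    linear_combination (norm := module) aeval (t k r (x ^ 2 - 2)) (f n) • hA
  rw [h₁, e, smul_eq_zero, or_iff_left hne, neg_eq_zero, C]
  simp

end Matrices

/-! ### The points of the double cover are the nonabelian characters -/

section Points

open Polynomial

open Matrix (trace_fin_two SpecialLinearGroup)

theorem two_two_notMem_C (k l : ℤ) : ((2 : ℂ), (2 : ℂ)) ∉ C k l := by
  have h : -((l / 2 : ℤ) : ℂ) + ((l / 2 : ℤ) - 1) ≠ 0 := by
    rw [neg_add_eq_sub, sub_sub_cancel_left]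
    simp
  simpa [C, t, aeval_f_two] using h

/-- Given traces are those of a noncommuting pair, one matrix upper and one lower triangular, with
the same diagonal. At the excluded point such a pair commutes; this point is not on `C(k,l)` by
`two_two_notMem_C`. -/
theorem exists_noncommuting {r x : ℂ} (h : ¬ (r = 2 ∧ x ^ 2 = 4)) :
    ∃ u v : SpecialLinearGroup (Fin 2) ℂ, (mat u).trace = x ∧ (mat v).trace = x ∧
      (mat (u * v⁻¹)).trace = r ∧ u * v ≠ v * u := by
  -- The diagonal entries are the two eigenvalues `s` and `x - s` common to `u` and `v`.
  obtain ⟨s, hs⟩ : ∃ s : ℂ, s * (x - s) = 1 := by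
    obtain ⟨s, hs⟩ := IsAlgClosed.exists_eq_mul_self (x ^ 2 / 4 - 1)
    exact ⟨x / 2 + s, by linear_combination hs⟩
  let u : SpecialLinearGroup (Fin 2) ℂ := ⟨!![s, 1; 0, x - s], by simp [hs]⟩
  let v : SpecialLinearGroup (Fin 2) ℂ := ⟨!![s, 0; 2 - r, x - s], by simp [hs]⟩
  have eu : mat u = !![s, 1; 0, x - s] := rfl
  have ev : mat v = !![s, 0; 2 - r, x - s] := rfl
  have hu : (mat u).trace = x := by simp [eu, trace_fin_two]
  have hv : (mat v).trace = x := by simp [ev, trace_fin_two]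
  refine ⟨u, v, hu, hv, ?_, fun huv => h ?_⟩
  · have h : (mat (u * v⁻¹)).trace = x ^ 2 - (mat u * mat v).trace := by
      rw [trace_mat_mul u v hu hv, sub_sub_cancel]
    rw [h, eu, ev]
    simp [trace_fin_two]
    linear_combination 2 * hs
  · have huv' : mat u * mat v = mat v * mat u := congrArg mat huv
    have h₁ := congrFun (congrFun huv' 0) 0
    have h₂ := congrFun (congrFun huv' 0) 1
    simp [eu, ev] at h₁ h₂
    refine ⟨by linear_combination -h₁, ?_⟩
    linear_combination 4 * hs + (x - 2 * s) * h₂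

/-- As `a` and `b` generate the group, a representation with `ρ a = ρ b` has a cyclic image. -/
theorem map_a_ne_map_b {k l : ℤ} {ρ : Rep (linkGroup k l)} (hρ : IsNonabelian ρ) :
    ρ (a k l) ≠ ρ (b k l) := by
  rintro h
  obtain ⟨γ, δ, hne⟩ := hρ
  have hmem : ∀ γ, ρ γ ∈ Subgroup.zpowers (ρ (a k l)) := by
    intro γ
    have hγ : γ ∈ Subgroup.closure {a k l, b k l} := closure_a_b k l ▸ Subgroup.mem_top γ
    have := Subgroup.mem_map_of_mem ρ hγ
    rwa [MonoidHom.map_closure, Set.image_pair, ← h, Set.pair_eq_singleton,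
      ← Subgroup.zpowers_eq_closure] at this
  obtain ⟨i, hi⟩ := hmem γ
  obtain ⟨j, hj⟩ := hmem δ
  simp only at hi hj
  rw [← hi, ← hj] at hne
  exact hne (Commute.zpow_zpow_self _ i j)

theorem character_eq_of_isConj {Γ : Type} [Group Γ] {a b : Γ} (ρ : Rep Γ) (hab : IsConj a b) :
    character ρ a = character ρ b := by
  obtain ⟨c, rfl⟩ := isConj_iff.mp hab
  change _ = (mat (ρ (c * a * c⁻¹))).trace
  rw [map_mul, mat_mul, Matrix.trace_mul_comm, ← mat_mul, map_mul, map_inv, inv_mul_cancel_left]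
  rfl

/-- The points of the double cover are the pairs of traces of nonabelian representations, reducible
ones included. -/
theorem mem_C_iff {k l : ℤ} (hl : Even l) (p : ℂ × ℂ) : (p.1, p.2 ^ 2 - 2) ∈ C k l ↔
    ∃ ρ : Rep (linkGroup k l), IsNonabelian ρ ∧
      p = (character ρ (a k l * (b k l)⁻¹), character ρ (a k l)) := by
  constructor
  · intro hp
    obtain ⟨u, v, hu, hv, hr, huv⟩ : ∃ u v : SpecialLinearGroup (Fin 2) ℂ, (mat u).trace = p.2 ∧
        (mat v).trace = p.2 ∧ (mat (u * v⁻¹)).trace = p.1 ∧ u * v ≠ v * u := by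
      refine exists_noncommuting fun ⟨h₁, h₂⟩ => two_two_notMem_C k l ?_
      rw [h₁, h₂] at hp
      convert hp using 2
      norm_num
    have hne : u ≠ v := fun h => huv (by rw [h])
    obtain ⟨ρ, ha, hb⟩ := exists_hom k l u v ((relation_iff_mem_C hl hu hv hr hne).mpr hp)
    refine ⟨ρ, ⟨a k l, b k l, by rwa [ha, hb]⟩, Prod.ext ?_ ?_⟩
    · simp [character, ha, hb, ← hr]
    · simp [character, ha, ← hu]
  · rintro ⟨ρ, hρ, rfl⟩
    refine (relation_iff_mem_C hl (u := ρ (a k l)) (v := ρ (b k l)) rfl ?_ ?_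
      (map_a_ne_map_b hρ)).mp ?_
    · exact (character_eq_of_isConj ρ (isConj_a_b k l hl)).symm
    · rw [character, map_mul, map_inv]
    · rw [← map_inv, ← map_twist, ← map_twist, ← b_eq_twist]

end Points

/-! ### Characters as functions of two traces -/

section Plane

/-- A set whose regular functions are the polynomials in an injective map to the plane is
isomorphic to its image, and so is every subset. -/
def VarietyIso.ofPlaneMap {S : Type} {π : S → ℂ × ℂ} (hπ : Function.Injective π)
    {A : Subalgebra ℂ (S → ℂ)} (hA : A = planeFunctions.map (pullback π)) (Z : Set S)
    {D : Set (ℂ × ℂ)} (hD : π '' Z = D) :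
    VarietyIso (restrictTo A Z) (restrictTo planeFunctions D) where
  toEquiv := (Equiv.Set.image π Z hπ).trans (Equiv.setCongr hD)
  regular_iff f := by
    subst hA hD
    constructor
    · rintro ⟨_, ⟨P, hP, rfl⟩, h⟩
      refine ⟨P, hP, funext fun d => ?_⟩
      obtain ⟨z, rfl⟩ := (Equiv.Set.image π Z hπ).surjective d
      exact congrFun h z
    · rintro ⟨P, hP, rfl⟩
      exact ⟨_, ⟨P, hP, rfl⟩, rfl⟩

/-- The first coordinate function of the plane. -/
def fstFun : planeFunctions := ⟨Prod.fst, Algebra.subset_adjoin (by simp)⟩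

/-- The second coordinate function of the plane. -/
def sndFun : planeFunctions := ⟨Prod.snd, Algebra.subset_adjoin (by simp)⟩

theorem fstFun_apply (z : ℂ × ℂ) : fstFun.1 z = z.1 := rfl

theorem sndFun_apply (z : ℂ × ℂ) : sndFun.1 z = z.2 := rfl

/-- The decomposition of a polynomial into its even and its odd part with respect to the second
variable, with `x ^ 2 - 2` in place of `x ^ 2`. -/
theorem exists_even_add_odd {P : ℂ × ℂ → ℂ} (hP : P ∈ planeFunctions) :
    ∃ Q₀ Q₁ : planeFunctions, ∀ r x : ℂ,
      P (r, x) = Q₀.1 (r, x ^ 2 - 2) + x * Q₁.1 (r, x ^ 2 - 2) := by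
  induction hP using Algebra.adjoin_induction with
  | mem P hP =>
    obtain rfl | rfl := hP
    · exact ⟨fstFun, 0, fun r x => by simp [fstFun_apply]⟩
    · exact ⟨0, 1, fun r x => by simp⟩
  | algebraMap c => exact ⟨algebraMap ℂ _ c, 0, fun r x => by simp⟩
  | add P P' _ _ h h' =>
    obtain ⟨Q₀, Q₁, h⟩ := h
    obtain ⟨Q₀', Q₁', h'⟩ := h'
    refine ⟨Q₀ + Q₀', Q₁ + Q₁', fun r x => ?_⟩
    simp only [Pi.add_apply, h, h', Subalgebra.coe_add]
    ring
  | mul P P' _ _ h h' =>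
    obtain ⟨Q₀, Q₁, h⟩ := h
    obtain ⟨Q₀', Q₁', h'⟩ := h'
    refine ⟨Q₀ * Q₀' + (sndFun + 2) * (Q₁ * Q₁'), Q₀ * Q₁' + Q₁ * Q₀', fun r x => ?_⟩
    have h2 : ((2 : planeFunctions) : ℂ × ℂ → ℂ) = 2 := rfl
    simp only [Pi.add_apply, Pi.mul_apply, h, h', Subalgebra.coe_add, Subalgebra.coe_mul,
      sndFun_apply, h2, Pi.ofNat_apply]
    ring

end Plane

section Characters

variable {Γ : Type} [Group Γ] {a b : Γ}

/-- The map of `Tr(Γ)` to the plane given by the traces of `a * b⁻¹` and `a`. -/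
def traces (a b : Γ) (χ : Tr Γ) : ℂ × ℂ := (χ.1 (a * b⁻¹), χ.1 a)

/-- The character of a representation as a point of `Tr(Γ)`. -/
def trOf (ρ : Rep Γ) : Tr Γ := ⟨character ρ, ρ, rfl⟩

/-- If `Γ` is generated by `a` and `b`, then every representation maps `γ` to a linear combination
of `1`, `ρ a`, `ρ b` and `ρ a * ρ b`, with coefficients that are polynomials in the traces of
`ρ (a * b⁻¹)` and `ρ a`. -/
theorem exists_expansion (hgen : Subgroup.closure {a, b} = ⊤) (hab : IsConj a b) (γ : Γ) :
    ∃ P₁ P₂ P₃ P₄ : planeFunctions, ∀ ρ : Rep Γ, mat (ρ γ) =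
      P₁.1 (traces a b (trOf ρ)) • (1 : Matrix (Fin 2) (Fin 2) ℂ) +
        P₂.1 (traces a b (trOf ρ)) • mat (ρ a) + P₃.1 (traces a b (trOf ρ)) • mat (ρ b) +
        P₄.1 (traces a b (trOf ρ)) • (mat (ρ a) * mat (ρ b)) := by
  have htr (ρ : Rep Γ) : (mat (ρ b)).trace = character ρ a := (character_eq_of_isConj ρ hab).symm
  have haa (ρ : Rep Γ) : mat (ρ a) * mat (ρ a) = character ρ a • mat (ρ a) - 1 := mat_mul_self _
  have hbb (ρ : Rep Γ) : mat (ρ b) * mat (ρ b) = character ρ a • mat (ρ b) - 1 := by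
    rw [← htr]
    exact mat_mul_self _
  have hba (ρ : Rep Γ) : mat (ρ b) * mat (ρ a) = character ρ a • mat (ρ a) +
      character ρ a • mat (ρ b) - character ρ (a * b⁻¹) • (1 : Matrix (Fin 2) (Fin 2) ℂ) -
        mat (ρ a) * mat (ρ b) := by
    rw [mat_mul_comm _ _ (x := character ρ a) rfl (htr ρ), ← map_inv, ← map_mul]
    rfl
  have haba (ρ : Rep Γ) : mat (ρ a) * mat (ρ b) * mat (ρ a) =
      (character ρ a ^ 2 - character ρ (a * b⁻¹)) • mat (ρ a) + mat (ρ b) - character ρ a • 1 := by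
    rw [mul_assoc, hba]
    simp only [mul_sub, mul_add, mul_smul_comm, ← mul_assoc, haa, sub_mul, smul_mul_assoc, one_mul,
      mul_one]
    module
  have habb (ρ : Rep Γ) : mat (ρ a) * mat (ρ b) * mat (ρ b) =
      character ρ a • (mat (ρ a) * mat (ρ b)) - mat (ρ a) := by
    rw [mul_assoc, hbb, mul_sub, mul_smul_comm, mul_one]
  have hr (ρ : Rep Γ) : fstFun.1 (traces a b (trOf ρ)) = character ρ (a * b⁻¹) := rfl
  have hx (ρ : Rep Γ) : sndFun.1 (traces a b (trOf ρ)) = character ρ a := rfl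
  have hainv (ρ : Rep Γ) : mat (ρ a)⁻¹ = character ρ a • 1 - mat (ρ a) := mat_inv _
  have hbinv (ρ : Rep Γ) : mat (ρ b)⁻¹ = character ρ a • 1 - mat (ρ b) := by
    rw [← htr]
    exact mat_inv _
  induction hgen ▸ Subgroup.mem_top γ using Subgroup.closure_induction_right with
  | one => exact ⟨1, 0, 0, 0, fun ρ => by simp⟩
  | mul_right γ _ c hc h =>
    obtain ⟨P₁, P₂, P₃, P₄, h⟩ := h
    obtain rfl | rfl := hc
    · refine ⟨-P₂ - fstFun * P₃ - sndFun * P₄,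
        P₁ + sndFun * P₂ + sndFun * P₃ + (sndFun * sndFun - fstFun) * P₄, sndFun * P₃ + P₄, -P₃,
        fun ρ => ?_⟩
      rw [map_mul, mat_mul, h]
      simp only [add_mul, smul_mul_assoc, one_mul, haa, hba, haba, Subalgebra.coe_add,
        Subalgebra.coe_sub, Subalgebra.coe_mul, Subalgebra.coe_neg, Pi.add_apply, Pi.sub_apply,
        Pi.mul_apply, Pi.neg_apply, hr, hx]
      module
    · refine ⟨-P₃, -P₄, P₁ + sndFun * P₃, P₂ + sndFun * P₄, fun ρ => ?_⟩
      rw [map_mul, mat_mul, h]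
      simp only [add_mul, smul_mul_assoc, one_mul, hbb, habb, Subalgebra.coe_add,
        Subalgebra.coe_mul, Subalgebra.coe_neg, Pi.add_apply, Pi.mul_apply, Pi.neg_apply, hx]
      module
  | mul_inv_cancel γ _ c hc h =>
    obtain ⟨P₁, P₂, P₃, P₄, h⟩ := h
    obtain rfl | rfl := hc
    · refine ⟨sndFun * P₁ + P₂ + fstFun * P₃ + sndFun * P₄,
        -P₁ - sndFun * P₃ - (sndFun * sndFun - fstFun) * P₄, -P₄, sndFun * P₄ + P₃,
        fun ρ => ?_⟩
      rw [map_mul, map_inv, mat_mul, h]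
      simp only [hainv, mul_sub, mul_smul_comm, mul_one, add_mul, smul_mul_assoc, one_mul, haa,
        hba, haba, Subalgebra.coe_add, Subalgebra.coe_sub, Subalgebra.coe_mul, Subalgebra.coe_neg,
        Pi.add_apply, Pi.sub_apply, Pi.mul_apply, Pi.neg_apply, hr, hx]
      module
    · refine ⟨sndFun * P₁ + P₃, sndFun * P₂ + P₄, -P₁, -P₂, fun ρ => ?_⟩
      rw [map_mul, map_inv, mat_mul, h]
      simp only [hbinv, mul_sub, mul_smul_comm, mul_one, add_mul, smul_mul_assoc, one_mul, hbb,
        habb, Subalgebra.coe_add, Subalgebra.coe_mul, Subalgebra.coe_neg, Pi.add_apply,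
        Pi.mul_apply, Pi.neg_apply, hx]
      module

theorem exists_character_eq (hgen : Subgroup.closure {a, b} = ⊤) (hab : IsConj a b) (γ : Γ) :
    ∃ P : planeFunctions, ∀ χ : Tr Γ, χ.1 γ = P.1 (traces a b χ) := by
  obtain ⟨P₁, P₂, P₃, P₄, h⟩ := exists_expansion hgen hab γ
  suffices key : ∃ P : planeFunctions, ∀ ρ : Rep Γ,
      character ρ γ = P.1 (traces a b (trOf ρ)) by
    obtain ⟨P, hP⟩ := key
    refine ⟨P, ?_⟩
    rintro ⟨_, ρ, rfl⟩
    exact hP ρ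
  refine ⟨P₁ + P₁ + sndFun * P₂ + sndFun * P₃ + (sndFun * sndFun - fstFun) * P₄, fun ρ => ?_⟩
  have hb : (mat (ρ b)).trace = character ρ a := (character_eq_of_isConj ρ hab).symm
  have hm : (mat (ρ a) * mat (ρ b)).trace = character ρ a ^ 2 - character ρ (a * b⁻¹) := by
    rw [trace_mat_mul _ _ rfl hb, ← map_inv, ← map_mul]
    rfl
  have hr : fstFun.1 (traces a b (trOf ρ)) = character ρ (a * b⁻¹) := rfl
  have hx : sndFun.1 (traces a b (trOf ρ)) = character ρ a := rfl
  have ha : (mat (ρ a)).trace = character ρ a := rfl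
  refine (congrArg Matrix.trace (h ρ)).trans ?_
  simp only [Matrix.trace_add, Matrix.trace_smul, Matrix.trace_one, ha, hb, hm, Subalgebra.coe_add,
    Subalgebra.coe_sub, Subalgebra.coe_mul, Pi.add_apply, Pi.sub_apply, Pi.mul_apply, hr, hx,
    smul_eq_mul, Fintype.card_fin]
  push_cast
  ring

theorem traces_injective (hgen : Subgroup.closure {a, b} = ⊤) (hab : IsConj a b) :
    Function.Injective (traces a b) := by
  refine fun χ χ' h => Subtype.ext (funext fun γ => ?_)
  obtain ⟨P, hP⟩ := exists_character_eq hgen hab γ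
  rw [hP, hP, h]

/-- The coordinate ring of `Tr(Γ)` consists of the polynomials in the two traces. -/
theorem TrFunctions_eq (hgen : Subgroup.closure {a, b} = ⊤) (hab : IsConj a b) :
    TrFunctions Γ = planeFunctions.map (pullback (traces a b)) := by
  apply le_antisymm
  · refine Algebra.adjoin_le ?_
    rintro _ ⟨γ, rfl⟩
    obtain ⟨P, hP⟩ := exists_character_eq hgen hab γ
    exact ⟨P.1, P.2, funext fun χ => (hP χ).symm⟩
  · rw [planeFunctions, AlgHom.map_adjoin]
    refine Algebra.adjoin_mono ?_
    rintro _ ⟨_, rfl | rfl, rfl⟩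
    · exact ⟨a * b⁻¹, rfl⟩
    · exact ⟨a, rfl⟩

end Characters

/-! ### The quotient by the sign characters -/

section Signs

variable {Γ : Type} [Group Γ] {a b : Γ}

/-- The product of a representation with a homomorphism to `{±1}`. -/
def signTwist (σ : Γ →* ℤˣ) (ρ : Rep Γ) : Rep Γ where
  toFun γ := ⟨((σ γ : ℤ) : ℂ) • mat (ρ γ), by
    have h : ((σ γ : ℤ) : ℂ) ^ 2 = 1 := by
      rw [sq, ← Int.cast_mul, ← Units.val_mul, Int.units_mul_self]
      simp
    rw [Matrix.det_smul, Fintype.card_fin, h, one_mul]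
    exact (ρ γ).2⟩
  map_one' := Subtype.ext (by simp)
  map_mul' γ δ := Subtype.ext (by
    change ((σ (γ * δ) : ℤ) : ℂ) • mat (ρ (γ * δ)) =
      (((σ γ : ℤ) : ℂ) • mat (ρ γ)) * (((σ δ : ℤ) : ℂ) • mat (ρ δ))
    rw [smul_mul_smul_comm, map_mul, map_mul, mat_mul]
    push_cast
    rfl)

theorem character_signTwist (σ : Γ →* ℤˣ) (ρ : Rep Γ) (γ : Γ) :
    character (signTwist σ ρ) γ = ((σ γ : ℤ) : ℂ) * character ρ γ :=
  Matrix.trace_smul _ _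

theorem sq_character (χ : Tr Γ) (γ : Γ) : χ.1 (γ ^ 2) = χ.1 γ ^ 2 - 2 := by
  obtain ⟨_, ρ, rfl⟩ := χ
  change (mat (ρ (γ ^ 2))).trace = (mat (ρ γ)).trace ^ 2 - 2
  rw [map_pow, sq, mat_mul, mat_mul_self]
  simp [sq]

theorem sign_eq_of_isConj (hab : IsConj a b) (σ : Γ →* ℤˣ) : σ a = σ b := by
  obtain ⟨c, rfl⟩ := isConj_iff.mp hab
  rw [map_mul, map_mul, map_inv, mul_inv_cancel_comm]

/-- Some element of `Hom(Γ, {±1})` acts on the traces by `(r, x) ↦ (r, -x)`. -/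
theorem exists_neg_trace (hab : IsConj a b) (hσ : ∃ σ : Γ →* ℤˣ, σ a = -1) (χ : Tr Γ) :
    ∃ χ' : Tr Γ, toPTr Γ χ = toPTr Γ χ' ∧
      traces a b χ' = ((traces a b χ).1, -(traces a b χ).2) := by
  obtain ⟨σ, hσ⟩ := hσ
  obtain ⟨_, ρ, rfl⟩ := χ
  refine ⟨trOf (signTwist σ ρ), Quotient.sound ⟨σ, character_signTwist σ ρ⟩, Prod.ext ?_ ?_⟩
  · change character (signTwist σ ρ) (a * b⁻¹) = character ρ (a * b⁻¹)
    rw [character_signTwist, map_mul, map_inv, sign_eq_of_isConj hab, mul_inv_cancel]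
    simp
  · change character (signTwist σ ρ) a = -character ρ a
    rw [character_signTwist, hσ]
    simp

/-- The map of `PTr(Γ)` to the plane given by the traces of `a * b⁻¹` and `a ^ 2`. -/
def pTraces (hab : IsConj a b) : PTr Γ → ℂ × ℂ :=
  Quotient.lift (fun χ : Tr Γ => (χ.1 (a * b⁻¹), χ.1 (a ^ 2))) (by
    rintro χ χ' ⟨σ, h⟩
    simp only [h, map_mul, map_inv, sign_eq_of_isConj hab, mul_inv_cancel, sq,
      Int.units_mul_self]
    simp)

theorem pTraces_toPTr (hab : IsConj a b) (χ : Tr Γ) :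
    pTraces hab (toPTr Γ χ) = (χ.1 (a * b⁻¹), χ.1 (a ^ 2)) := rfl

theorem pTraces_toPTr' (hab : IsConj a b) (χ : Tr Γ) :
    pTraces hab (toPTr Γ χ) = ((traces a b χ).1, (traces a b χ).2 ^ 2 - 2) := by
  rw [pTraces_toPTr, sq_character]
  rfl

theorem pTraces_injective (hgen : Subgroup.closure {a, b} = ⊤) (hab : IsConj a b)
    (hσ : ∃ σ : Γ →* ℤˣ, σ a = -1) : Function.Injective (pTraces hab) := by
  rintro ⟨χ⟩ ⟨χ'⟩ h
  change pTraces hab (toPTr Γ χ) = pTraces hab (toPTr Γ χ') at h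
  change toPTr Γ χ = toPTr Γ χ'
  rw [pTraces_toPTr', pTraces_toPTr', Prod.mk.injEq, sub_left_inj, sq_eq_sq_iff_eq_or_eq_neg] at h
  obtain ⟨h₁, h₂ | h₂⟩ := h
  · rw [traces_injective hgen hab (Prod.ext h₁ h₂)]
  · obtain ⟨χ'', e, h''⟩ := exists_neg_trace hab hσ χ'
    have e' : traces a b χ = traces a b χ'' := by rw [h'', ← h₁, ← h₂]
    rw [e, traces_injective hgen hab e']

/-- The coordinate ring of `PTr(Γ)` consists of the polynomials in the traces of `a * b⁻¹` and
`a ^ 2`, as a polynomial in `r` and `x` that takes the same values at `(r, x)` and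
`(r, -x)` agrees with its even part. -/
theorem PTrFunctions_eq (hgen : Subgroup.closure {a, b} = ⊤) (hab : IsConj a b)
    (hσ : ∃ σ : Γ →* ℤˣ, σ a = -1) :
    PTrFunctions Γ = planeFunctions.map (pullback (pTraces hab)) := by
  apply le_antisymm
  · intro G hG
    obtain ⟨P, hP, hPG⟩ : pullback (toPTr Γ) G ∈ planeFunctions.map (pullback (traces a b)) :=
      TrFunctions_eq hgen hab ▸ hG
    obtain ⟨Q₀, Q₁, hQ⟩ := exists_even_add_odd hP
    have hG' (χ : Tr Γ) : G (toPTr Γ χ) = P ((traces a b χ).1, (traces a b χ).2) :=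
      (congrFun hPG χ).symm
    refine ⟨Q₀.1, Q₀.2, funext ?_⟩
    rintro ⟨χ⟩
    change Q₀.1 (pTraces hab (toPTr Γ χ)) = G (toPTr Γ χ)
    obtain ⟨χ', e, h'⟩ := exists_neg_trace hab hσ χ
    have h₁ := hG' χ
    have h₂ := hG' χ'
    rw [← e, h'] at h₂
    rw [hQ] at h₁ h₂
    rw [neg_sq] at h₂
    rw [pTraces_toPTr']
    linear_combination -(h₁ + h₂) / 2
  · rintro _ ⟨P, hP, rfl⟩
    change pullback (toPTr Γ) (pullback (pTraces hab) P) ∈ TrFunctions Γ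
    induction hP using Algebra.adjoin_induction with
    | mem P hP =>
      obtain rfl | rfl := hP
      · exact Algebra.subset_adjoin ⟨a * b⁻¹, rfl⟩
      · exact Algebra.subset_adjoin ⟨a ^ 2, rfl⟩
    | algebraMap c =>
      rw [AlgHom.commutes, AlgHom.commutes]
      exact Subalgebra.algebraMap_mem _ c
    | add P P' _ _ h h' =>
      rw [map_add, map_add]
      exact add_mem h h'
    | mul P P' _ _ h h' =>
      rw [map_mul, map_mul]
      exact mul_mem h h'

end Signs

/-! ### The images in the plane -/

section Images

variable {k l : ℤ}

theorem image_traces_X (hl : Even l) :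
    traces (a k l) (b k l) '' X (linkGroup k l) = DoubleCover k l := by
  ext p
  rw [DoubleCover, Set.mem_ofPred_eq, mem_C_iff hl]
  constructor
  · rintro ⟨χ, ⟨ρ, hρ, hχ⟩, rfl⟩
    exact ⟨ρ, hρ, by rw [hχ]; rfl⟩
  · rintro ⟨ρ, hρ, rfl⟩
    exact ⟨trOf ρ, ⟨ρ, hρ, rfl⟩, rfl⟩

theorem image_pTraces_Y (hl : Even l) :
    pTraces (isConj_a_b k l hl) '' Y (linkGroup k l) = C k l := by
  have hX := image_traces_X (k := k) hl
  ext ⟨r, y⟩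
  constructor
  · rintro ⟨_, ⟨χ, hχ, rfl⟩, h⟩
    rw [pTraces_toPTr'] at h
    rw [← h]
    have hmem : traces (a k l) (b k l) χ ∈ DoubleCover k l := hX ▸ Set.mem_image_of_mem _ hχ
    exact hmem
  · intro h
    obtain ⟨x, hx⟩ := IsAlgClosed.exists_pow_nat_eq (y + 2) two_pos
    have hy : x ^ 2 - 2 = y := by rw [hx, add_sub_cancel_right]
    have hmem : (r, x) ∈ DoubleCover k l := by
      change (r, x ^ 2 - 2) ∈ C k l
      rwa [hy]
    rw [← hX] at hmem
    obtain ⟨χ, hχ, e⟩ := hmem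
    exact ⟨_, ⟨χ, hχ, rfl⟩, by rw [pTraces_toPTr', e, hy]⟩

end Images

end DoubleTwist

end

theorem proposition3p6 (k l : ℤ) (hl : Even l) :
    ∃ (eY : DoubleTwist.VarietyIso
          (DoubleTwist.YFunctions (DoubleTwist.linkGroup k l))
          (DoubleTwist.restrictTo DoubleTwist.planeFunctions (DoubleTwist.C k l)))
      (eX : DoubleTwist.VarietyIso
          (DoubleTwist.XFunctions (DoubleTwist.linkGroup k l))
          (DoubleTwist.restrictTo DoubleTwist.planeFunctions (DoubleTwist.DoubleCover k l))),
      ∀ χ : DoubleTwist.X (DoubleTwist.linkGroup k l),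
        (eX.toEquiv χ).1 =
          (χ.1.1 (DoubleTwist.a k l * (DoubleTwist.b k l)⁻¹), χ.1.1 (DoubleTwist.a k l)) ∧
        (eY.toEquiv (DoubleTwist.XtoY χ)).1 =
          (χ.1.1 (DoubleTwist.a k l * (DoubleTwist.b k l)⁻¹), χ.1.1 (DoubleTwist.a k l ^ 2)) ∧
        eY.toEquiv (DoubleTwist.XtoY χ) = DoubleTwist.coverMap (eX.toEquiv χ) := by
  have hgen := DoubleTwist.closure_a_b k l
  have hab := DoubleTwist.isConj_a_b k l hl
  have hσ := DoubleTwist.exists_sign k l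
  refine ⟨.ofPlaneMap (DoubleTwist.pTraces_injective hgen hab hσ)
      (DoubleTwist.PTrFunctions_eq hgen hab hσ) _ (DoubleTwist.image_pTraces_Y hl),
    .ofPlaneMap (DoubleTwist.traces_injective hgen hab) (DoubleTwist.TrFunctions_eq hgen hab) _
      (DoubleTwist.image_traces_X hl),
    fun χ => ⟨rfl, rfl, Subtype.ext ?_⟩⟩
  exact DoubleTwist.pTraces_toPTr' hab χ.1
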